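/- Let $\mathbb M=(M,<,\dots)$ be an o-minimal structure (every subset of $M$ definable with parameters is a finite union of points and open intervals with endpoints in $M\cup\{\pm\infty\}$), and let $\mathbb P\preceq\mathbb M$, with domain $P$, be a prime model over $\emptyset$ of its theory. Say that $\mathbb M$ has definable Skolem functions if for every family $\{X_t\}_{t\in T}$ of nonempty subsets of some $M^k$ that is uniformly definable with parameters there is a function $h:T\to M^k$, definable with parameters, such that $h(t)\in X_t$ for all $t\in T$. For a set $A$ let $\mathrm{dcl}(A)$ be the set of elements $u$ such that $\{u\}$ is definable over $A$. Call an elementary extension of $\mathbb M$ (possibly $\mathbb M$ itself) sufficiently saturated if it is $\kappa$-saturated for some cardinal $\kappa>|P|$. Then: 1. If $\mathbb M$ has definable Skolem functions, then $\mathrm{dcl}(C\cup P)\preceq\mathbb M$ for every $C\subseteq M$. 2. If $\mathbb M$ is sufficiently saturated, then $\mathbb M$ has definable Skolem functions if and only if $\mathrm{dcl}(C\cup P)\preceq\mathbb M$ for every $C\subseteq M$. 3. For arbitrary $\mathbb M$ and every sufficiently saturated elementary extension $\mathbb N\succeq\mathbb M$, with domain $N$, the structure $\mathbb M$ has definable Skolem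 functions if and only if $\mathrm{dcl}(C\cup P)\preceq\mathbb N$ for every $C\subseteq N$, where $\mathrm{dcl}$ is computed in $\mathbb N$. -/

import Mathlib

open FirstOrder Cardinal

universe u v w w'

namespace OMin

/-- Points and open intervals of a linear order, the endpoints of the intervals lying in `M ∪ {±∞}`. -/
def IsPointOrInterval {M : Type w} [LinearOrder M] (I : Set M) : Prop :=
  (∃ a, I = {a}) ∨ (∃ a b, I = Set.Ioo a b) ∨ (∃ a, I = Set.Ioi a) ∨ (∃ b, I = Set.Iio b) ∨
    I = Set.univ

/-- A linearly ordered structure is o-minimal if every subset of its domain that is definable with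
parameters is a finite union of points and open intervals. -/
def IsOMinimal (L : FirstOrder.Language.{u, v}) (M : Type w) [LinearOrder M] [L.Structure M] : Prop :=
  ∀ S : Set M, (Set.univ : Set M).Definable₁ L S →
    ∃ F : Set (Set M), F.Finite ∧ (∀ I ∈ F, IsPointOrInterval I) ∧ S = ⋃₀ F

/-- Every family `(X t)_{t ∈ T}` of nonempty subsets of `M ^ k` that is uniformly definable with
parameters has a section `h : T → M ^ k` that is definable with parameters. -/
def HasDefinableSkolemFunctions (L : FirstOrder.Language.{u, v}) (M : Type w) [L.Structure M] : Prop :=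
  ∀ (n k : ℕ) (T : Set (Fin n → M)) (X : (Fin n → M) → Set (Fin k → M)),
    (Set.univ : Set M).Definable L T →
    (Set.univ : Set M).Definable L
      {x : Fin n ⊕ Fin k → M | x ∘ Sum.inl ∈ T ∧ x ∘ Sum.inr ∈ X (x ∘ Sum.inl)} →
    (∀ t ∈ T, (X t).Nonempty) →
    ∃ h : T → (Fin k → M),
      (Set.univ : Set M).Definable L
        {x : Fin n ⊕ Fin k → M | ∃ ht : x ∘ Sum.inl ∈ T, h ⟨x ∘ Sum.inl, ht⟩ = x ∘ Sum.inr} ∧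
      ∀ t : T, h t ∈ X t

/-- The definable closure of a set of parameters. -/
def dcl (L : FirstOrder.Language.{u, v}) {M : Type w} [L.Structure M] (A : Set M) : Set M :=
  {a | A.Definable₁ L {a}}

/-- The set `A` is the domain of an elementary substructure of `M`. -/
def IsElementarySubset (L : FirstOrder.Language.{u, v}) {M : Type w} [L.Structure M] (A : Set M) : Prop :=
  ∃ S : L.ElementarySubstructure M, (S : Set M) = A

/-- `P` is a prime model (over the empty set) of its complete theory: it embeds elementarily into
every model of that theory. By the downward Löwenheim–Skolem theorem, models in
`Type (max u v w)` decide this for models in all universes. -/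
def IsPrimeModel (L : FirstOrder.Language.{u, v}) (P : Type w) [L.Structure P] : Prop :=
  ∀ (N : Type (max u v w)) [L.Structure N], N ⊨ L.completeTheory P → Nonempty (P ↪ₑ[L] N)

/-- `κ`-saturation: over fewer than `κ` parameters, every set of formulas in finitely many
variables that is finitely satisfiable in `M` is realized in `M`. -/
def IsSaturated (L : FirstOrder.Language.{u, v}) (M : Type w) [L.Structure M] (κ : Cardinal.{w}) : Prop :=
  ∀ A : Set M, #A < κ → ∀ (n : ℕ) (p : Set (L[[A]].Formula (Fin n))),
    (∀ q : Set (L[[A]].Formula (Fin n)), q ⊆ p → q.Finite →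
      ∃ x : Fin n → M, ∀ φ ∈ q, φ.Realize x) →
    ∃ x : Fin n → M, ∀ φ ∈ p, φ.Realize x

/-- `M` is `κ`-saturated for some cardinal `κ` greater than the cardinality of `P`. -/
def IsSufficientlySaturated (L : FirstOrder.Language.{u, v}) {M : Type w} [L.Structure M] (P : Set M) : Prop :=
  ∃ κ : Cardinal.{w}, #P < κ ∧ IsSaturated L M κ

end OMin

/-!
Turning parameters into variables, one sees that `M` has definable Skolem functions iff every family
of sets definable over `∅` has a Skolem function definable with parameters in `M`. This is a
property of the complete theory: for each formula `φ`, some formula `ψ` defines a Skolem function of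
`φ` for suitable values of its parameters. Hence the parameters can be found in an elementary
substructure `P`, and then a nonempty set definable over `C ∪ P` has a point in `dcl (C ∪ P)`, which
is the Tarski–Vaught criterion.

Conversely, if `dcl (t ∪ P)` is always an elementary substructure, then at every single index `t`
some `P`-definable family selects a point of the fibre. By saturation finitely many such families
suffice for all indices, and they can be glued definably: at `t` use the first one that works.
-/

namespace OMin

open FirstOrder.Language Set

variable {L : FirstOrder.Language.{u, v}} {K : Type w} [L.Structure K] {K' : Type w'}
  [L.Structure K'] {α β : Type*} {A B : Set K} {m n k : ℕ}

section Definability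

/-- The fibre over `t` of a family `S ⊆ K ^ (α ⊕ β)` of subsets of `K ^ β` indexed by `K ^ α`. -/
def fiber (S : Set (α ⊕ β → K)) (t : α → K) : Set (β → K) :=
  {y | Sum.elim t y ∈ S}

@[simp]
theorem mem_fiber {S : Set (α ⊕ β → K)} {t : α → K} {y : β → K} :
    y ∈ fiber S t ↔ Sum.elim t y ∈ S :=
  Iff.rfl

theorem definable_setOf_realize (φ : L.Formula α) : A.Definable L {v : α → K | φ.Realize v} :=
  (empty_definable_iff.2 ⟨φ, rfl⟩).mono (empty_subset A)

theorem subset_dcl : A ⊆ dcl L A := fun _ ha => Definable.singleton_of_mem L ha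

theorem definable_singleton_iff [Finite α] {x : α → K} :
    A.Definable L {x} ↔ ∀ i, x i ∈ dcl L A := by
  constructor
  · intro hx i
    have hxi : A.Definable L {a : Fin 1 → K | a = fun _ => x i} := by
      simpa using! hx.image_comp fun _ : Fin 1 => i
    simpa [dcl, Definable₁, funext_iff] using hxi
  · intro hx
    have hcoord : A.Definable L (⋂ i, {v : α → K | v i = x i}) :=
      definable_iInter_of_finite fun i => (hx i).preimage_comp fun _ : Fin 1 => i
    convert hcoord
    ext v
    simp [funext_iff]

theorem definable_fiber [Finite α] {S : Set (α ⊕ β → K)} {t : α → K} (hS : A.Definable L S)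
    (ht : ∀ i, t i ∈ dcl L A) : A.Definable L (fiber S t) := by
  have hgraph : A.Definable L {y : β → K | ∃ u : α → K, Sum.elim u y ∈ S ∧ u = t} := by
    simpa using! ((hS.preimage_comp Sum.swap).inter
      ((definable_singleton_iff.2 ht).preimage_comp Sum.inr)).exists_of_finite
  simpa [fiber] using! hgraph

theorem exists_definable_fiber_eq {S : Set (β → K)} {t : α → K}
    (hS : (range t ∪ A).Definable L S) :
    ∃ Ψ : Set (α ⊕ β → K), A.Definable L Ψ ∧ fiber Ψ t = S := by
  obtain ⟨φ, rfl⟩ := definable_iff_exists_formula_sum.1 hS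
  have hvar (c : ↥(range t ∪ A)) : ∃ s : A ⊕ (α ⊕ β),
      ∀ y : β → K, Sum.elim (↑) (Sum.elim t y) s = (c : K) := by
    obtain ⟨c, ⟨i, rfl⟩ | hc⟩ := c
    · exact ⟨Sum.inr (Sum.inl i), fun _ => rfl⟩
    · exact ⟨Sum.inl ⟨c, hc⟩, fun _ => rfl⟩
  choose s hs using hvar
  refine ⟨_, definable_iff_exists_formula_sum.2
    ⟨φ.relabel (Sum.elim s (Sum.inr ∘ Sum.inr)), rfl⟩, ?_⟩
  ext y
  simp only [mem_fiber, mem_ofPred_eq, Formula.realize_relabel]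
  refine iff_of_eq (congrArg _ (funext ?_))
  rintro (c | i)
  · exact hs c y
  · rfl

theorem exists_formula_fiber_eq {S : Set (α → K)} (hS : A.Definable L S) :
    ∃ (m : ℕ) (p : Fin m → K) (φ : L.Formula (Fin m ⊕ α)), (∀ i, p i ∈ A) ∧
      fiber {v | φ.Realize v} p = S := by
  obtain ⟨A₀, hA₀, hS⟩ := definable_iff_finitely_definable.1 hS
  let p : Fin A₀.card → K := fun i => A₀.equivFin.symm i
  have hp : range p = A₀ :=
    (A₀.equivFin.symm.surjective.range_comp _).trans Subtype.range_coe
  rw [← hp, ← union_empty (range p)] at hS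
  obtain ⟨Φ, hΦ, hfiber⟩ := exists_definable_fiber_eq hS
  obtain ⟨φ, rfl⟩ := empty_definable_iff.1 hΦ
  exact ⟨_, p, φ, fun i => hA₀ (hp ▸ mem_range_self i), hfiber⟩

theorem definable_dcl_iff {S : Set (α → K)} : (dcl L A).Definable L S ↔ A.Definable L S := by
  refine ⟨fun hS => ?_, fun hS => hS.mono subset_dcl⟩
  obtain ⟨m, p, φ, hp, rfl⟩ := exists_formula_fiber_eq hS
  exact definable_fiber (definable_setOf_realize φ) hp

end Definability

section Selectors

/-- The family `Ψ` is a Skolem function of the family `Φ` at the index `t`: unless the fibre of `Φ`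
over `t` is empty, the fibre of `Ψ` over `t` consists of a single point of it. -/
def SelectsAt (Φ Ψ : Set (α ⊕ β → K)) (t : α → K) : Prop :=
  (fiber Φ t).Nonempty → ∃ y ∈ fiber Φ t, fiber Ψ t = {y}

theorem SelectsAt.congr {α' : Type*} {Φ Ψ : Set (α ⊕ β → K)} {Φ' Ψ' : Set (α' ⊕ β → K)}
    {t : α → K} {t' : α' → K} (h : SelectsAt Φ Ψ t) (hΦ : fiber Φ' t' = fiber Φ t)
    (hΨ : fiber Ψ' t' = fiber Ψ t) : SelectsAt Φ' Ψ' t' := by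
  rwa [SelectsAt, hΦ, hΨ]

/-- The formula in the index variables expressing that `ψ` defines a Skolem function of the family
defined by `φ`, in the sense of `SelectsAt`. -/
noncomputable def selectsAtFormula [Finite β] (φ ψ : L.Formula (α ⊕ β)) : L.Formula α :=
  (φ.iExs β).imp (ψ.iExsUnique β ⊓ (ψ.imp φ).iAlls β)

theorem realize_selectsAtFormula [Finite β] {φ ψ : L.Formula (α ⊕ β)} {t : α → K} :
    (selectsAtFormula φ ψ).Realize t ↔ SelectsAt {v | φ.Realize v} {v | ψ.Realize v} t := by
  simp only [selectsAtFormula, Formula.realize_imp, Formula.realize_inf, Formula.realize_iExs,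
    Formula.realize_iExsUnique, Formula.realize_iAlls]
  refine imp_congr_right fun _ => ⟨?_, ?_⟩
  · rintro ⟨⟨y, hy, huniq⟩, hsub⟩
    exact ⟨y, hsub y hy, Subset.antisymm huniq (singleton_subset_iff.2 hy)⟩
  · rintro ⟨y, hyΦ, hyΨ⟩
    have hψ (z : β → K) : ψ.Realize (Sum.elim t z) ↔ z = y := Set.ext_iff.1 hyΨ z
    simpa [hψ, ExistsUnique] using! hyΦ

theorem definable_setOf_selectsAt [Finite β] {Φ Ψ : Set (α ⊕ β → K)} (hΦ : A.Definable L Φ)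
    (hΨ : A.Definable L Ψ) : A.Definable L {t | SelectsAt Φ Ψ t} := by
  obtain ⟨φ, rfl⟩ := hΦ
  obtain ⟨ψ, rfl⟩ := hΨ
  exact ⟨selectsAtFormula φ ψ, Set.ext fun _ => realize_selectsAtFormula.symm⟩

/-- The family `Φ` has, over the index set `W`, a Skolem function definable with parameters in
`A`. -/
def HasSelectorOn (L : FirstOrder.Language.{u, v}) [L.Structure K] (A : Set K)
    (Φ : Set (α ⊕ β → K)) (W : Set (α → K)) : Prop :=
  ∃ Ψ : Set (α ⊕ β → K), A.Definable L Ψ ∧ ∀ t ∈ W, SelectsAt Φ Ψ t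

theorem hasSelectorOn_empty (Φ : Set (α ⊕ β → K)) : HasSelectorOn L A Φ ∅ :=
  ⟨∅, definable_empty, fun _ ht => ht.elim⟩

theorem HasSelectorOn.union [Finite β] {Φ : Set (α ⊕ β → K)} {V W : Set (α → K)}
    (hΦ : A.Definable L Φ) (hV : HasSelectorOn L A Φ V) (hW : HasSelectorOn L A Φ W) :
    HasSelectorOn L A Φ (V ∪ W) := by
  obtain ⟨Ψ₁, hΨ₁, hsel₁⟩ := hV
  obtain ⟨Ψ₂, hΨ₂, hsel₂⟩ := hW
  set D : Set (α ⊕ β → K) := {v | SelectsAt Φ Ψ₁ (v ∘ Sum.inl)} with hD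
  have hD_def : A.Definable L D := (definable_setOf_selectsAt hΦ hΨ₁).preimage_comp Sum.inl
  refine ⟨D.ite Ψ₁ Ψ₂, (hΨ₁.inter hD_def).union (hΨ₂.sdiff hD_def), fun t ht => ?_⟩
  by_cases hsel : SelectsAt Φ Ψ₁ t
  · exact hsel.congr rfl (by ext y; simp [Set.ite, hD, hsel])
  · exact (hsel₂ t (ht.resolve_left (hsel <| hsel₁ t ·))).congr rfl
      (by ext y; simp [Set.ite, hD, hsel])

theorem HasSelectorOn.sUnion [Finite β] {Φ : Set (α ⊕ β → K)} {q : Set (Set (α → K))}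
    (hΦ : A.Definable L Φ) (hq : q.Finite) (h : ∀ W ∈ q, HasSelectorOn L A Φ W) :
    HasSelectorOn L A Φ (⋃₀ q) := by
  induction q, hq using Set.Finite.induction_on with
  | empty => simpa using hasSelectorOn_empty Φ
  | insert _ _ ih =>
    rw [sUnion_insert]
    exact (h _ (mem_insert _ _)).union hΦ (ih fun W hW => h W (mem_insert_of_mem _ hW))

/-- Every family definable without parameters has a Skolem function definable with parameters in
`A`. -/
def HasSelectorsOver (L : FirstOrder.Language.{u, v}) [L.Structure K] (A : Set K) : Prop :=
  ∀ (n k : ℕ) (φ : L.Formula (Fin n ⊕ Fin k)),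
    HasSelectorOn L A {v : Fin n ⊕ Fin k → K | φ.Realize v} univ

theorem HasSelectorsOver.mono (h : HasSelectorsOver L A) (hAB : A ⊆ B) : HasSelectorsOver L B :=
  fun n k φ =>
    let ⟨Ψ, hΨ, hsel⟩ := h n k φ
    ⟨Ψ, hΨ.mono hAB, hsel⟩

theorem HasSelectorsOver.hasSelectorOn (h : HasSelectorsOver L A) {Φ : Set (Fin n ⊕ Fin k → K)}
    (hΦ : A.Definable L Φ) : HasSelectorOn L A Φ univ := by
  obtain ⟨m, p, φ, hp, rfl⟩ := exists_formula_fiber_eq hΦ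
  let e : Fin (m + n) ⊕ Fin k ≃ Fin m ⊕ (Fin n ⊕ Fin k) :=
    (finSumFinEquiv.symm.sumCongr (Equiv.refl _)).trans (Equiv.sumAssoc _ _ _)
  obtain ⟨Ψ, hΨ, hsel⟩ := h (m + n) k (φ.relabel e.symm)
  have helim (t : Fin n → K) (y : Fin k → K) :
      Sum.elim p (Sum.elim t y) ∘ e = Sum.elim (Fin.append p t) y := by
    funext i
    rcases i with i | i
    · induction i using Fin.addCases <;> simp [e]
    · simp [e]
  refine ⟨fiber {v | v ∘ e ∈ Ψ} p,
    definable_fiber (hΨ.preimage_comp e) fun i => subset_dcl (hp i), fun t _ =>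
      (hsel (Fin.append p t) (mem_univ _)).congr ?_ ?_⟩
  · ext y
    simp [← helim, Function.comp_assoc]
  · ext y
    simp [helim]

theorem HasDefinableSkolemFunctions.hasSelectorsOver_univ
    (h : HasDefinableSkolemFunctions L K) : HasSelectorsOver L (univ : Set K) := by
  intro n k φ
  set Φ : Set (Fin n ⊕ Fin k → K) := {v | φ.Realize v}
  have hΦ : univ.Definable L Φ := definable_setOf_realize φ
  have hfamily : {v : Fin n ⊕ Fin k → K |
      v ∘ Sum.inl ∈ {t | (fiber Φ t).Nonempty} ∧ v ∘ Sum.inr ∈ fiber Φ (v ∘ Sum.inl)} = Φ := by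
    ext v
    simpa using fun hv => ⟨v ∘ Sum.inr, by simpa using hv⟩
  obtain ⟨f, hf, hfΦ⟩ := h n k {t | (fiber Φ t).Nonempty} (fiber Φ) hΦ.exists_of_finite
    (by rwa [hfamily]) fun t ht => ht
  refine ⟨_, hf, fun t _ ht => ⟨f ⟨t, ht⟩, hfΦ ⟨t, ht⟩, ?_⟩⟩
  ext y
  exact ⟨fun ⟨_, hy⟩ => hy.symm, fun hy => ⟨ht, hy.symm⟩⟩

theorem HasSelectorsOver.hasDefinableSkolemFunctions
    (h : HasSelectorsOver L (univ : Set K)) : HasDefinableSkolemFunctions L K := by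
  intro n k T X hT hX hne
  obtain ⟨Ψ, hΨ, hsel⟩ := h.hasSelectorOn hX
  have hselT (t : T) : ∃ y ∈ X t, fiber Ψ t = {y} := by
    have hfiber : fiber {v : Fin n ⊕ Fin k → K | v ∘ Sum.inl ∈ T ∧ v ∘ Sum.inr ∈ X (v ∘ Sum.inl)} t
        = X t := by
      ext y
      simp [fiber]
    have hselt := hsel t (mem_univ _)
    rw [SelectsAt, hfiber] at hselt
    exact hselt (hne t t.2)
  choose f hfX hfΨ using hselT
  refine ⟨f, ?_, hfX⟩
  convert (hT.preimage_comp Sum.inl).inter hΨ using 1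
  ext v
  have hgraph (ht : v ∘ Sum.inl ∈ T) : f ⟨v ∘ Sum.inl, ht⟩ = v ∘ Sum.inr ↔ v ∈ Ψ := by
    simpa [eq_comm] using (Set.ext_iff.1 (hfΨ ⟨_, ht⟩) (v ∘ Sum.inr)).symm
  simp [hgraph]

theorem hasSelectorsOver_univ_iff :
    HasSelectorsOver L (univ : Set K) ↔ HasDefinableSkolemFunctions L K :=
  ⟨HasSelectorsOver.hasDefinableSkolemFunctions,
    HasDefinableSkolemFunctions.hasSelectorsOver_univ⟩

end Selectors

section Transfer

/-- The formula in the parameter variables of `ψ` expressing that `ψ` defines a Skolem function of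
the family defined by `φ`. -/
noncomputable def selectorFormula (φ : L.Formula (Fin n ⊕ Fin k))
    (ψ : L.Formula (Fin m ⊕ (Fin n ⊕ Fin k))) : L.Formula (Fin m) :=
  (selectsAtFormula (φ.relabel (Sum.map Sum.inr id))
    (ψ.relabel (Equiv.sumAssoc _ _ _).symm)).iAlls (Fin n)

theorem realize_selectorFormula {φ : L.Formula (Fin n ⊕ Fin k)}
    {ψ : L.Formula (Fin m ⊕ (Fin n ⊕ Fin k))} {p : Fin m → K} :
    (selectorFormula φ ψ).Realize p ↔
      ∀ t, SelectsAt {v | φ.Realize v} (fiber {v | ψ.Realize v} p) t := by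
  have helim (t : Fin n → K) (y : Fin k → K) :
      Sum.elim (Sum.elim p t) y ∘ (Equiv.sumAssoc (Fin m) (Fin n) (Fin k)).symm =
        Sum.elim p (Sum.elim t y) := by
    funext i
    rcases i with i | i | i <;> rfl
  simp [selectorFormula, Formula.realize_iAlls, realize_selectsAtFormula, SelectsAt, fiber,
    Formula.realize_relabel, helim, Sum.elim_comp_map]

theorem hasSelectorsOver_iff_exists_realize :
    HasSelectorsOver L A ↔ ∀ (n k : ℕ) (φ : L.Formula (Fin n ⊕ Fin k)),
      ∃ (m : ℕ) (ψ : L.Formula (Fin m ⊕ (Fin n ⊕ Fin k))) (p : Fin m → K),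
        (∀ i, p i ∈ A) ∧ (selectorFormula φ ψ).Realize p := by
  simp only [realize_selectorFormula]
  refine forall₃_congr fun n k φ => ⟨?_, ?_⟩
  · rintro ⟨Ψ, hΨ, hsel⟩
    obtain ⟨m, p, ψ, hp, rfl⟩ := exists_formula_fiber_eq hΨ
    exact ⟨m, ψ, p, hp, fun t => hsel t (mem_univ t)⟩
  · rintro ⟨m, ψ, p, hp, hsel⟩
    exact ⟨_, definable_fiber (definable_setOf_realize ψ) fun i => subset_dcl (hp i),
      fun t _ => hsel t⟩

theorem hasDefinableSkolemFunctions_iff_exists_realize :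
    HasDefinableSkolemFunctions L K ↔ ∀ (n k : ℕ) (φ : L.Formula (Fin n ⊕ Fin k)),
      ∃ (m : ℕ) (ψ : L.Formula (Fin m ⊕ (Fin n ⊕ Fin k))) (p : Fin m → K),
        (selectorFormula φ ψ).Realize p := by
  simp [← hasSelectorsOver_univ_iff, hasSelectorsOver_iff_exists_realize]

theorem hasSelectorsOver_range_iff (g : K ↪ₑ[L] K') :
    HasSelectorsOver L (range g) ↔ HasDefinableSkolemFunctions L K := by
  rw [hasSelectorsOver_iff_exists_realize, hasDefinableSkolemFunctions_iff_exists_realize]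
  refine forall₃_congr fun n k φ => exists₂_congr fun m ψ => ⟨?_, ?_⟩
  · rintro ⟨p, hp, hsel⟩
    choose q hq using hp
    obtain rfl : g ∘ q = p := funext hq
    exact ⟨q, (g.map_formula _ q).1 hsel⟩
  · rintro ⟨q, hsel⟩
    exact ⟨g ∘ q, fun i => mem_range_self _, (g.map_formula _ q).2 hsel⟩

theorem hasDefinableSkolemFunctions_congr (h : K ≅[L] K') :
    HasDefinableSkolemFunctions L K ↔ HasDefinableSkolemFunctions L K' := by
  have hexs {m : ℕ} (φ : L.Formula (Fin m)) : (∃ p : Fin m → K, φ.Realize p) ↔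
      ∃ p : Fin m → K', φ.Realize p := by
    simpa [Sentence.Realize] using elementarilyEquivalent_iff.1 h ((φ.relabel Sum.inr).iExs (Fin m))
  simp only [hasDefinableSkolemFunctions_iff_exists_realize, hexs]

theorem hasSelectorsOver_image_iff (f : K ↪ₑ[L] K') (P : L.ElementarySubstructure K) :
    HasSelectorsOver L (f '' (P : Set K)) ↔ HasDefinableSkolemFunctions L K := by
  rw [image_eq_range]
  exact (hasSelectorsOver_range_iff (f.comp P.subtype)).trans
    (hasDefinableSkolemFunctions_congr P.elementarilyEquivalent)

end Transfer

section DefinableClosure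

theorem HasSelectorsOver.exists_mem_dcl (h : HasSelectorsOver L A) {D : Set (Fin k → K)}
    (hD : A.Definable L D) (hne : D.Nonempty) : ∃ y ∈ D, ∀ i, y i ∈ dcl L A := by
  obtain ⟨Ψ, hΨ, hsel⟩ := h.hasSelectorOn (hD.preimage_comp (Sum.inr : Fin k → Fin 0 ⊕ Fin k))
  obtain ⟨y, hy, hyΨ⟩ := hsel Fin.elim0 (mem_univ _) hne
  refine ⟨y, hy, definable_singleton_iff.1 ?_⟩
  rw [← hyΨ]
  exact definable_fiber hΨ fun i => i.elim0

theorem HasSelectorsOver.isElementarySubset_dcl (h : HasSelectorsOver L A) :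
    IsElementarySubset L (dcl L A) := by
  have hmeets : L.MeetsDefinable (dcl L A) := fun X ⟨a, ha⟩ hX =>
    let ⟨y, hyX, hy⟩ := h.exists_mem_dcl (definable_dcl_iff.1 hX) ⟨fun _ => a, ha⟩
    ⟨y 0, hyX, hy 0⟩
  exact ⟨hmeets.toElementarySubstructure, hmeets.closure_eq_self⟩

theorem IsElementarySubset.exists_mem [Finite β] (hB : IsElementarySubset L B) {D : Set (β → K)}
    (hD : B.Definable L D) (hne : D.Nonempty) : ∃ x ∈ D, ∀ i, x i ∈ B := by
  obtain ⟨S, rfl⟩ := hB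
  obtain ⟨φ, rfl⟩ := definable_iff_exists_formula_sum.1 hD
  have hS : (φ.iExs β).Realize (id : S → S) :=
    (S.subtype.map_formula _ id).1 (Formula.realize_iExs.2 hne)
  obtain ⟨x, hx⟩ := Formula.realize_iExs.1 hS
  refine ⟨fun i => x i, ?_, fun i => (x i).2⟩
  rw [← S.subtype.map_formula, Sum.comp_elim] at hx
  exact hx

theorem exists_definable_selectsAt [Finite α] [Finite β] {Φ : Set (α ⊕ β → K)} {t : α → K}
    (hΦ : A.Definable L Φ) (h : IsElementarySubset L (dcl L (range t ∪ A))) :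
    ∃ Ψ : Set (α ⊕ β → K), A.Definable L Ψ ∧ SelectsAt Φ Ψ t := by
  obtain hempty | hne := (fiber Φ t).eq_empty_or_nonempty
  · exact ⟨∅, definable_empty, fun hne => (hne.ne_empty hempty).elim⟩
  have ht (i : α) : t i ∈ dcl L (range t ∪ A) := subset_dcl (Or.inl (mem_range_self i))
  have hfiber := definable_fiber (hΦ.mono subset_union_right) ht
  obtain ⟨x, hxΦ, hx⟩ := h.exists_mem (definable_dcl_iff.2 hfiber) hne
  obtain ⟨Ψ, hΨ, hΨx⟩ := exists_definable_fiber_eq (definable_singleton_iff.2 hx)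
  exact ⟨Ψ, hΨ, fun _ => ⟨x, hxΦ, hΨx⟩⟩

theorem IsSaturated.exists_finite_sUnion_eq_univ {κ : Cardinal.{w}} (hK : IsSaturated L K κ)
    (hA : #A < κ) {𝒰 : Set (Set (Fin n → K))} (h𝒰 : ∀ U ∈ 𝒰, A.Definable L U)
    (hcover : ⋃₀ 𝒰 = Set.univ) : ∃ q ⊆ 𝒰, q.Finite ∧ ⋃₀ q = Set.univ := by
  by_contra! hno
  let unrealized (χ : L[[A]].Formula (Fin n)) : Set (Fin n → K) := {x | ¬ χ.Realize x}
  obtain ⟨x, hx⟩ := hK A hA n (unrealized ⁻¹' 𝒰) fun q hq hqfin => by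
    obtain ⟨x, hx⟩ := (ne_univ_iff_exists_notMem _).1
      (hno (unrealized '' q) (image_subset_iff.2 hq) (hqfin.image _))
    exact ⟨x, by simpa [unrealized] using hx⟩
  obtain ⟨U, hU, hxU⟩ : x ∈ ⋃₀ 𝒰 := hcover ▸ mem_univ x
  obtain ⟨χ, hχ⟩ := (h𝒰 U hU).compl
  have h_unrealized : unrealized χ = U := by rw [← compl_compl U, hχ]; rfl
  exact (h_unrealized ▸ hxU) (hx χ (by rwa [mem_preimage, h_unrealized]))

theorem hasSelectorsOver_of_isElementarySubset_dcl (hK : IsSufficientlySaturated L A)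
    (h : ∀ C : Set K, IsElementarySubset L (dcl L (C ∪ A))) : HasSelectorsOver L A := by
  intro n k φ
  obtain ⟨κ, hκ, hsat⟩ := hK
  set Φ : Set (Fin n ⊕ Fin k → K) := {v | φ.Realize v}
  have hΦ : A.Definable L Φ := definable_setOf_realize φ
  obtain ⟨q, hq, hqfin, hquniv⟩ := hsat.exists_finite_sUnion_eq_univ hκ
    (𝒰 := {U | A.Definable L U ∧ HasSelectorOn L A Φ U}) (fun U hU => hU.1) (by
      refine eq_univ_of_forall fun t => ?_
      obtain ⟨Ψ, hΨ, hsel⟩ := exists_definable_selectsAt hΦ (h (range t))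
      exact ⟨_, ⟨definable_setOf_selectsAt hΦ hΨ, Ψ, hΨ, fun _ => id⟩, hsel⟩)
  rw [← hquniv]
  exact HasSelectorOn.sUnion hΦ hqfin fun U hU => (hq hU).2

theorem HasSelectorsOver.isElementarySubset_dcl_union (h : HasSelectorsOver L A) (C : Set K) :
    IsElementarySubset L (dcl L (C ∪ A)) :=
  (h.mono subset_union_right).isElementarySubset_dcl

theorem IsSufficientlySaturated.hasSelectorsOver_iff (hK : IsSufficientlySaturated L A) :
    HasSelectorsOver L A ↔ ∀ C : Set K, IsElementarySubset L (dcl L (C ∪ A)) :=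
  ⟨HasSelectorsOver.isElementarySubset_dcl_union, hasSelectorsOver_of_isElementarySubset_dcl hK⟩

end DefinableClosure

end OMin

theorem mainTheorem6_general {L : FirstOrder.Language.{u, v}} {M : Type w} [L.Structure M]
    (P : L.ElementarySubstructure M) :
    (OMin.HasDefinableSkolemFunctions L M →
      ∀ C : Set M, OMin.IsElementarySubset L (OMin.dcl L (C ∪ (P : Set M)))) ∧
    (OMin.IsSufficientlySaturated L (P : Set M) →
      (OMin.HasDefinableSkolemFunctions L M ↔
        ∀ C : Set M, OMin.IsElementarySubset L (OMin.dcl L (C ∪ (P : Set M))))) ∧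
    (∀ (N : Type w') [L.Structure N] (f : M ↪ₑ[L] N),
      OMin.IsSufficientlySaturated L (f '' (P : Set M)) →
      (OMin.HasDefinableSkolemFunctions L M ↔
        ∀ C : Set N, OMin.IsElementarySubset L (OMin.dcl L (C ∪ f '' (P : Set M))))) := by
  have hskolem : OMin.HasSelectorsOver L (P : Set M) ↔ OMin.HasDefinableSkolemFunctions L M := by
    rw [← OMin.hasSelectorsOver_image_iff (Language.ElementaryEmbedding.refl L M) P]
    exact iff_of_eq (congrArg _ (Set.image_id _).symm)
  refine ⟨fun h => (hskolem.2 h).isElementarySubset_dcl_union,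
    fun hsat => hskolem.symm.trans hsat.hasSelectorsOver_iff, fun N _ f hsat => ?_⟩
  exact (OMin.hasSelectorsOver_image_iff f P).symm.trans hsat.hasSelectorsOver_iff

theorem mainTheorem6 {L : FirstOrder.Language.{u, v}} [L.IsOrdered] {M : Type w} [LinearOrder M]
    [L.Structure M] [L.OrderedStructure M] (hM : OMin.IsOMinimal L M)
    (P : L.ElementarySubstructure M) (hP : OMin.IsPrimeModel L P) :
    (OMin.HasDefinableSkolemFunctions L M →
      ∀ C : Set M, OMin.IsElementarySubset L (OMin.dcl L (C ∪ (P : Set M)))) ∧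
    (OMin.IsSufficientlySaturated L (P : Set M) →
      (OMin.HasDefinableSkolemFunctions L M ↔
        ∀ C : Set M, OMin.IsElementarySubset L (OMin.dcl L (C ∪ (P : Set M))))) ∧
    (∀ (N : Type w') [L.Structure N] (f : M ↪ₑ[L] N),
      OMin.IsSufficientlySaturated L (f '' (P : Set M)) →
      (OMin.HasDefinableSkolemFunctions L M ↔
        ∀ C : Set N, OMin.IsElementarySubset L (OMin.dcl L (C ∪ f '' (P : Set M))))) :=
  mainTheorem6_general P
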